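/- Let $d\ge 1$, let $\mathbb{S}$ be the unit sphere of $\mathbb{R}^d$ and $\sigma$ its surface area measure, normalised to $\sigma(\mathbb{S})=1$. Let $\mathrm{Harm}_k(\mathbb{S})$ be the space of restrictions to $\mathbb{S}$ of the real homogeneous harmonic polynomials of degree $k$ on $\mathbb{R}^d$, and for $L\subset\mathbb{N}=\{0,1,2,\dots\}$ let $P_L=\bigoplus_{k\in L}\mathrm{Harm}_k(\mathbb{S})$. Let $Q_k=C_k^{(d/2)}-C_{k-2}^{(d/2)}$, where $C_k^{(\lambda)}$ are the Gegenbauer polynomials and $C_k^{(\lambda)}:=0$ for $k<0$ (so $Q_0=1$, and for $d\ge2$ the $Q_k$ are the orthogonal polynomials for the weight $(1-x^2)^{(d-3)/2}$ on $[-1,1]$ with $Q_k(1)=\dim \mathrm{Harm}_k(\mathbb{S})$). A sequence $\Phi=(v_1,\dots,v_n)$, $n\ge1$, of points of $\mathbb{S}$ is a (spherical) $P$-design, for a space $P$ of polynomials (or of functions on $\mathbb{S}$), if $$\int_{\mathbb{S}} p\,d\sigma=\frac1n\sum_{j=1}^n p(v_j)\qquad\text{for all } p\in P.$$ Its angles are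 the inner products $\langle v_j,v_k\rangle$ with $v_j\ne v_k$. Theorem (Lower bound). Let $P$ be a space of real polynomials on $\mathbb{R}^d$ whose space of restrictions to $\mathbb{S}$ is $P_L$ (such an $L$ exists whenever $P$ is invariant under orthogonal transformations), and let $F=\sum_k f_kQ_k$ be a univariate polynomial (a finite sum, $f_k\in\mathbb{R}$) with $$\{k: f_k>0\}=L\cup\{0\},\qquad F(\alpha)\ge 0\quad\text{for all }\alpha\in[-1,1].$$ Then every $P$-design $\Phi=(v_1,\dots,v_n)$ satisfies $$n\ge\frac{F(1)}{f_0},$$ with equality if and only if the points $v_1,\dots,v_n$ are pairwise distinct, the angles of $\Phi$ are roots of $F$, and $\Phi$ is a spherical $P_K$-design for $K=\{k:f_k<0\}$. -/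

import Mathlib

open MeasureTheory Polynomial

noncomputable section

namespace SphericalDesign

/-- The unit sphere of `ℝ^d` with its Euclidean norm. -/
abbrev Sph (d : ℕ) : Type := Metric.sphere (0 : EuclideanSpace ℝ (Fin d)) 1

/-- The surface area measure on the unit sphere, normalised to total mass `1` (for `d ≥ 1`). -/
def surfaceMeasure (d : ℕ) : Measure (Sph d) :=
  ((volume : Measure (EuclideanSpace ℝ (Fin d))).toSphere Set.univ)⁻¹ •
    (volume : Measure (EuclideanSpace ℝ (Fin d))).toSphere

/-- Restriction of real polynomials on `ℝ^d` to the unit sphere, as a linear map. -/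
def restrict (d : ℕ) : MvPolynomial (Fin d) ℝ →ₗ[ℝ] (Sph d → ℝ) where
  toFun p := fun x => MvPolynomial.eval (fun i => x.1 i) p
  map_add' p q := by ext x; simp
  map_smul' c p := by ext x; simp [MvPolynomial.smul_eval]

/-- The Laplacian `∑ i, ∂²/∂x_i²` on polynomials. -/
def laplacian (d : ℕ) : MvPolynomial (Fin d) ℝ →ₗ[ℝ] MvPolynomial (Fin d) ℝ :=
  ∑ i : Fin d, (MvPolynomial.pderiv i).toLinearMap ∘ₗ (MvPolynomial.pderiv i).toLinearMap

/-- `Harm_k(ℝ^d)`: the homogeneous polynomials of degree `k` which are harmonic. -/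
def harm (d k : ℕ) : Submodule ℝ (MvPolynomial (Fin d) ℝ) :=
  MvPolynomial.homogeneousSubmodule (Fin d) ℝ k ⊓ LinearMap.ker (laplacian d)

/-- `P_L`: the sum of the spaces `Harm_k(𝕊)`, `k ∈ L`, of functions on the sphere. -/
def harmSpace (d : ℕ) (L : Set ℕ) : Submodule ℝ (Sph d → ℝ) :=
  ⨆ k ∈ L, (harm d k).map (restrict d)

/-- A weighted spherical design for a space `U` of functions on the sphere: nonnegative weights
with sum `1` for which the cubature rule integrates every function in `U`. -/
structure IsWeightedDesign {d n : ℕ} (U : Submodule ℝ (Sph d → ℝ)) (v : Fin n → Sph d)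
    (w : Fin n → ℝ) : Prop where
  nonneg : ∀ j, 0 ≤ w j
  sum_eq_one : ∑ j, w j = 1
  integral_eq : ∀ p ∈ U, ∫ x, p x ∂(surfaceMeasure d) = ∑ j, w j * p (v j)

/-- A (classical, unweighted) spherical design: all weights are `1 / n`.
In particular `n ≠ 0`, since the weights have sum `1`. -/
def IsDesign {d n : ℕ} (U : Submodule ℝ (Sph d → ℝ)) (v : Fin n → Sph d) : Prop :=
  IsWeightedDesign U v (fun _ => 1 / (n : ℝ))

/-- The angles of a sequence of points: the inner products of two different points of it. -/
def angles {d n : ℕ} (v : Fin n → Sph d) : Set ℝ :=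
  {a | ∃ j k, v j ≠ v k ∧
    a = inner ℝ (v j : EuclideanSpace ℝ (Fin d)) (v k : EuclideanSpace ℝ (Fin d))}

/-- The Gegenbauer (ultraspherical) polynomial
`C_m^(lam) = ∑ j ≤ m/2, (-1)^j (lam)_(m-j) / (j! (m-2j)!) (2x)^(m-2j)`,
with `(lam)_i = lam (lam + 1) ⋯ (lam + i - 1)`. -/
def gegenbauerC (lam : ℝ) (m : ℕ) : ℝ[X] :=
  ∑ j ∈ Finset.range (m / 2 + 1),
    C ((-1) ^ j * (ascPochhammer ℝ (m - j)).eval lam /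
      ((j.factorial : ℝ) * ((m - 2 * j).factorial : ℝ))) * (2 * X) ^ (m - 2 * j)

/-- `Q_k = C_k^(d/2) - C_(k-2)^(d/2)`, where `C_l^(d/2) = 0` for `l < 0`: the orthogonal
polynomials for the weight `(1 - x²)^((d-3)/2)` on `[-1,1]`, normalised by
`Q_k(1) = dim Harm_k(ℝ^d)`. -/
def Q (d : ℕ) : ℕ → ℝ[X]
  | 0 => gegenbauerC ((d : ℝ) / 2) 0
  | 1 => gegenbauerC ((d : ℝ) / 2) 1
  | k + 2 => gegenbauerC ((d : ℝ) / 2) (k + 2) - gegenbauerC ((d : ℝ) / 2) k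

end SphericalDesign

end

namespace SphericalDesign

/-! ### The Fischer inner product -/

/-! The sum of `F(⟨v_i, v_j⟩)` over all index pairs is computed in two ways. The diagonal gives `n
F(1)` and the rest is some `O ≥ 0`. Expanding in the `Q_k` gives `f_0 n² + R` with `R = ∑_{k≥1} f_k
S_k` and `S_k = ∑_{i,j} Q_k(⟨v_i, v_j⟩)`. Now `S_k ≥ 0`, and `S_k = 0` exactly when all harmonic
polynomials of degree `k` sum to zero over the points. The design property therefore kills the terms
with `f_k > 0`, the others are nonpositive, and `n (n f_0 - F(1)) = O - R ≥ 0`. Equality means `O =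
0` and `R = 0`.

The facts about `S_k` are algebraic. For the Fischer product, multiplication by `|x|²` is adjoint to
the Laplacian and `⟨y, x⟩^k` represents evaluation at `y` up to `k!`. So the harmonic polynomial
`zonal k y`, which is a multiple of `⟨y, x⟩^k` modulo `|x|²`, is a reproducing kernel, and `S_k` is
a positive multiple of a Fischer square (`fischer_zonalSum_self`, `sum_eval_Q_eq_zero_iff`).
Analysis enters only in `integral_restrict_harm`: harmonics of positive degree have mean zero, so
being a design means that point sums vanish. -/

/-- The Fischer inner product `(p, q) ↦ ∑ m, m! p_m q_m` on polynomials. -/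
noncomputable def fischer (d : ℕ) :
    MvPolynomial (Fin d) ℝ →ₗ[ℝ] MvPolynomial (Fin d) ℝ →ₗ[ℝ] ℝ :=
  (MvPolynomial.basisMonomials (Fin d) ℝ).constr ℝ fun m =>
    (∏ i, ((m i).factorial : ℝ)) • MvPolynomial.lcoeff ℝ m

variable {d : ℕ}

theorem fischer_monomial (m : Fin d →₀ ℕ) (a : ℝ) (q : MvPolynomial (Fin d) ℝ) :
    fischer d (MvPolynomial.monomial m a) q =
      a * ((∏ i, ((m i).factorial : ℝ)) * MvPolynomial.coeff m q) := by
  have h : MvPolynomial.monomial m a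
      = a • (MvPolynomial.basisMonomials (Fin d) ℝ) m := by
    simp [MvPolynomial.smul_monomial]
  rw [h, map_smul, fischer, Module.Basis.constr_basis]
  simp

theorem fischer_eq_sum (p q : MvPolynomial (Fin d) ℝ) :
    fischer d p q = ∑ m ∈ p.support, p.coeff m *
      ((∏ i, ((m i).factorial : ℝ)) * q.coeff m) := by
  conv_lhs => rw [p.as_sum, map_sum, LinearMap.sum_apply]
  exact Finset.sum_congr rfl fun m _ => fischer_monomial m _ q

theorem fischer_self_nonneg (p : MvPolynomial (Fin d) ℝ) : 0 ≤ fischer d p p := by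
  rw [fischer_eq_sum]
  refine Finset.sum_nonneg fun m _ => ?_
  have := mul_self_nonneg (p.coeff m)
  have h : (0 : ℝ) ≤ ∏ i, ((m i).factorial : ℝ) := by positivity
  nlinarith [mul_nonneg h this]

theorem eq_zero_of_fischer_self_eq_zero {p : MvPolynomial (Fin d) ℝ}
    (hp : fischer d p p = 0) : p = 0 := by
  have hpos : ∀ m ∈ p.support, 0 < p.coeff m *
      ((∏ i, ((m i).factorial : ℝ)) * p.coeff m) := by
    intro m hm
    have h1 : 0 < p.coeff m * p.coeff m :=
      mul_self_pos.2 (MvPolynomial.mem_support_iff.1 hm)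
    have h2 : (0 : ℝ) < ∏ i, ((m i).factorial : ℝ) := by positivity
    nlinarith [mul_pos h2 h1]
  rw [fischer_eq_sum, Finset.sum_eq_zero_iff_of_nonneg fun m hm => (hpos m hm).le] at hp
  ext m
  by_contra hm
  have hm' : m ∈ p.support := MvPolynomial.mem_support_iff.2 (by simpa using hm)
  exact (hpos m hm').ne' (hp m hm')

/-- Raising the exponent of `X i` multiplies the factorial weight by `m i + 1`, the same factor that
differentiation produces. -/
theorem fischer_X_mul (i : Fin d) (p q : MvPolynomial (Fin d) ℝ) :
    fischer d (MvPolynomial.X i * p) q = fischer d p (MvPolynomial.pderiv i q) := by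
  classical
  induction p using MvPolynomial.induction_on' with
  | add p p' hp hp' => simp [mul_add, hp, hp']
  | monomial m a =>
    rw [MvPolynomial.X, MvPolynomial.monomial_mul, fischer_monomial, fischer_monomial,
      MvPolynomial.coeff_pderiv, add_comm (Finsupp.single i 1) m]
    have h : ∏ j, (((m + Finsupp.single i 1 : Fin d →₀ ℕ) j).factorial : ℝ)
        = (∏ j, ((m j).factorial : ℝ)) * (m i + 1) := by
      rw [← Finset.mul_prod_erase _ _ (Finset.mem_univ i),
        ← Finset.mul_prod_erase _ (fun j => ((m j).factorial : ℝ)) (Finset.mem_univ i)]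
      have h2 : ∏ j ∈ Finset.univ.erase i,
          (((m + Finsupp.single i 1 : Fin d →₀ ℕ) j).factorial : ℝ)
          = ∏ j ∈ Finset.univ.erase i, ((m j).factorial : ℝ) := by
        refine Finset.prod_congr rfl fun j hj => ?_
        simp [(Finset.ne_of_mem_erase hj).symm]
      rw [h2]
      simp [Nat.factorial_succ]
      ring
    rw [h]
    ring

/-- The linear form `⟨y, ·⟩` as a polynomial. -/
noncomputable def linForm (y : Fin d → ℝ) : MvPolynomial (Fin d) ℝ :=
  ∑ i, MvPolynomial.C (y i) * MvPolynomial.X i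

/-- The squared norm as a polynomial. -/
noncomputable def normSqPoly (d : ℕ) : MvPolynomial (Fin d) ℝ :=
  ∑ i, MvPolynomial.X i ^ 2

theorem laplacian_apply (p : MvPolynomial (Fin d) ℝ) :
    laplacian d p = ∑ i, MvPolynomial.pderiv i (MvPolynomial.pderiv i p) := by
  simp [laplacian]

theorem fischer_normSqPoly_mul (p q : MvPolynomial (Fin d) ℝ) :
    fischer d (normSqPoly d * p) q = fischer d p (laplacian d q) := by
  rw [laplacian_apply, normSqPoly, Finset.sum_mul, map_sum, map_sum, LinearMap.sum_apply]
  refine Finset.sum_congr rfl fun i _ => ?_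
  rw [pow_two, mul_assoc, fischer_X_mul, fischer_X_mul]

/-- Moving one factor `⟨y, x⟩` across turns it into the derivative of `p` along `y`; after
induction, Euler's identity at `y` supplies the factor `k + 1`. -/
theorem fischer_linForm_pow (y : Fin d → ℝ) (k : ℕ) (p : MvPolynomial (Fin d) ℝ)
    (hp : p.IsHomogeneous k) :
    fischer d (linForm y ^ k) p = k.factorial * MvPolynomial.eval y p := by
  induction k generalizing p with
  | zero =>
    rw [← MvPolynomial.totalDegree_zero_iff_isHomogeneous,
      MvPolynomial.totalDegree_eq_zero_iff_eq_C] at hp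
    rw [hp, pow_zero, ← MvPolynomial.C_1, ← MvPolynomial.monomial_zero', fischer_monomial]
    simp
  | succ k ih =>
    have h : ∀ i, fischer d (MvPolynomial.C (y i) * MvPolynomial.X i * linForm y ^ k) p
        = k.factorial * (y i * MvPolynomial.eval y (MvPolynomial.pderiv i p)) := by
      intro i
      rw [mul_assoc, ← MvPolynomial.smul_eq_C_mul, map_smul, LinearMap.smul_apply, fischer_X_mul,
        ih _ hp.pderiv, smul_eq_mul]
      ring
    have he := congrArg (MvPolynomial.eval y) hp.sum_X_mul_pderiv
    simp only [map_sum, map_mul, MvPolynomial.eval_X, nsmul_eq_mul, map_natCast] at he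
    conv_lhs => rw [pow_succ', linForm, Finset.sum_mul, ← linForm, map_sum, LinearMap.sum_apply]
    rw [Finset.sum_congr rfl fun i _ => h i, ← Finset.mul_sum, he, Nat.factorial_succ]
    push_cast
    ring

/-! ### Zonal harmonics -/

theorem laplacian_mul (p q : MvPolynomial (Fin d) ℝ) :
    laplacian d (p * q) = laplacian d p * q + p * laplacian d q +
      2 * ∑ i, MvPolynomial.pderiv i p * MvPolynomial.pderiv i q := by
  simp only [laplacian_apply, Finset.sum_mul, Finset.mul_sum, ← Finset.sum_add_distrib]
  refine Finset.sum_congr rfl fun i _ => ?_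
  simp only [MvPolynomial.pderiv_mul, map_add]
  ring

theorem pderiv_linForm (y : Fin d → ℝ) (i : Fin d) :
    MvPolynomial.pderiv i (linForm y) = MvPolynomial.C (y i) := by
  classical
  simp only [linForm, map_sum, MvPolynomial.pderiv_C_mul, MvPolynomial.pderiv_X]
  rw [Finset.sum_eq_single i] <;> simp +contextual

theorem pderiv_normSqPoly (i : Fin d) :
    MvPolynomial.pderiv i (normSqPoly d) = 2 * MvPolynomial.X i := by
  classical
  simp only [normSqPoly, map_sum, MvPolynomial.pderiv_pow, MvPolynomial.pderiv_X]
  rw [Finset.sum_eq_single i] <;> simp +contextual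

theorem laplacian_linForm_pow {y : Fin d → ℝ} (hy : ∑ i, y i ^ 2 = 1) (m : ℕ) :
    laplacian d (linForm y ^ m) =
      MvPolynomial.C ((m : ℝ) * (m - 1 : ℝ)) * linForm y ^ (m - 2) := by
  have hy' : ∑ i, (MvPolynomial.C (y i) : MvPolynomial (Fin d) ℝ) ^ 2 = 1 := by
    simp only [← map_pow, ← map_sum, hy, map_one]
  rw [laplacian_apply]
  rcases m with _ | m
  · simp
  have h : ∀ i, MvPolynomial.pderiv i (MvPolynomial.pderiv i (linForm y ^ (m + 1)))
      = (((m : MvPolynomial (Fin d) ℝ) + 1) * (m : MvPolynomial (Fin d) ℝ) * linForm y ^ (m - 1)) *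
        MvPolynomial.C (y i) ^ 2 := by
    intro i
    have hc : ((m + 1 : ℕ) : MvPolynomial (Fin d) ℝ) = MvPolynomial.C ((m + 1 : ℕ) : ℝ) := by simp
    rw [MvPolynomial.pderiv_pow, pderiv_linForm, hc, mul_assoc, MvPolynomial.pderiv_C_mul,
      mul_comm _ (MvPolynomial.C (y i)), MvPolynomial.pderiv_C_mul, Nat.add_sub_cancel,
      MvPolynomial.pderiv_pow, pderiv_linForm]
    simp
    ring
  rw [Finset.sum_congr rfl fun i _ => h i, ← Finset.mul_sum, hy']
  simp

theorem laplacian_normSqPoly_pow (j : ℕ) :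
    laplacian d (normSqPoly d ^ j) =
      MvPolynomial.C ((4 * j * (j - 1) + 2 * d * j : ℝ)) * normSqPoly d ^ (j - 1) := by
  rw [laplacian_apply]
  rcases j with _ | j
  · simp
  have h : ∀ i, MvPolynomial.pderiv i (MvPolynomial.pderiv i (normSqPoly d ^ (j + 1)))
      = (((j : MvPolynomial (Fin d) ℝ) + 1) * 4 * (j : MvPolynomial (Fin d) ℝ) *
          normSqPoly d ^ (j - 1)) * MvPolynomial.X i ^ 2
        + 2 * (j + 1 : MvPolynomial (Fin d) ℝ) * normSqPoly d ^ j := by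
    intro i
    have hc : ((j + 1 : ℕ) : MvPolynomial (Fin d) ℝ) = MvPolynomial.C ((j + 1 : ℕ) : ℝ) := by simp
    have h2 : (2 : MvPolynomial (Fin d) ℝ) = MvPolynomial.C (2 : ℝ) := (map_ofNat _ 2).symm
    rw [MvPolynomial.pderiv_pow, pderiv_normSqPoly, hc, mul_assoc, MvPolynomial.pderiv_C_mul,
      Nat.add_sub_cancel, MvPolynomial.pderiv_mul]
    rw [show MvPolynomial.pderiv i (2 * MvPolynomial.X i : MvPolynomial (Fin d) ℝ) = 2 by
        rw [h2, MvPolynomial.pderiv_C_mul, MvPolynomial.pderiv_X_self, mul_one],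
      MvPolynomial.pderiv_pow, pderiv_normSqPoly]
    simp
    ring
  rw [Finset.sum_congr rfl fun i _ => h i, Finset.sum_add_distrib, ← Finset.mul_sum,
    ← normSqPoly]
  rcases j with _ | j
  · simp [map_ofNat]; ring
  · simp [map_ofNat]; ring

theorem sum_pderiv_linForm_pow_mul_pderiv_normSqPoly_pow (y : Fin d → ℝ) (m j : ℕ) :
    ∑ i, MvPolynomial.pderiv i (linForm y ^ m) * MvPolynomial.pderiv i (normSqPoly d ^ j) =
      MvPolynomial.C (2 * m * j : ℝ) * (linForm y ^ m * normSqPoly d ^ (j - 1)) := by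
  rcases m with _ | m
  · simp
  have h : ∀ i, MvPolynomial.pderiv i (linForm y ^ (m + 1)) *
      MvPolynomial.pderiv i (normSqPoly d ^ j) =
      (2 * ((m : MvPolynomial (Fin d) ℝ) + 1) * (j : MvPolynomial (Fin d) ℝ) *
        linForm y ^ m * normSqPoly d ^ (j - 1)) *
        (MvPolynomial.C (y i) * MvPolynomial.X i) := by
    intro i
    rw [MvPolynomial.pderiv_pow, MvPolynomial.pderiv_pow, pderiv_linForm, pderiv_normSqPoly]
    simp
    ring
  rw [Finset.sum_congr rfl fun i _ => h i, ← Finset.mul_sum, ← linForm]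
  simp [map_ofNat]
  ring

/-- The truncated exponents `m - 2` and `j - 1` are harmless: the coefficients vanish whenever
truncation occurs. -/
theorem laplacian_linForm_pow_mul_normSqPoly_pow {y : Fin d → ℝ} (hy : ∑ i, y i ^ 2 = 1)
    (m j : ℕ) :
    laplacian d (linForm y ^ m * normSqPoly d ^ j) =
      MvPolynomial.C ((m : ℝ) * (m - 1 : ℝ)) * (linForm y ^ (m - 2) * normSqPoly d ^ j) +
      MvPolynomial.C (2 * j * (2 * m + 2 * (j - 1) + d) : ℝ) *
        (linForm y ^ m * normSqPoly d ^ (j - 1)) := by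
  rw [laplacian_mul, laplacian_linForm_pow hy, laplacian_normSqPoly_pow,
    sum_pderiv_linForm_pow_mul_pderiv_normSqPoly_pow]
  simp only [map_mul, map_add, map_sub, map_natCast, map_ofNat, map_one]
  ring

/-- The coefficient of `x ^ (k - 2 * j)` in `Q d k`, for `1 ≤ k` and `2 * j ≤ k`. -/
noncomputable def QCoeff (d k j : ℕ) : ℝ :=
  (-1) ^ j * 2 ^ (k - 2 * j) * (ascPochhammer ℝ (k - 1 - j)).eval ((d : ℝ) / 2) *
    ((d : ℝ) / 2 + k - 1) / (j.factorial * (k - 2 * j).factorial)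

theorem QCoeff_zero_pos (hd : 1 ≤ d) {k : ℕ} (hk : 1 ≤ k) : 0 < QCoeff d k 0 := by
  have h1 : (0 : ℝ) < (d : ℝ) / 2 := by positivity
  have h2 : (1 : ℝ) ≤ k := by exact_mod_cast hk
  have h3 := ascPochhammer_pos (k - 1) ((d : ℝ) / 2) h1
  have h4 : (0 : ℝ) < (d : ℝ) / 2 + k - 1 := by linarith
  simp only [QCoeff, pow_zero, one_mul, Nat.sub_zero, mul_zero]
  positivity

/-- This two-term recursion is exactly the cancellation needed between neighbouring terms of the
Laplacian of `zonal`. -/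
theorem QCoeff_succ (k j : ℕ) (hj : 2 * (j + 1) ≤ k) :
    QCoeff d k (j + 1) * (2 * (j + 1) * (2 * (k - 2 * (j + 1)) + 2 * j + d)) =
      -(QCoeff d k j * ((k - 2 * j) * (k - 2 * j - 1))) := by
  obtain ⟨m, rfl⟩ : ∃ m, k = m + 2 * (j + 1) := ⟨k - 2 * (j + 1), by omega⟩
  have e1 : m + 2 * (j + 1) - 2 * (j + 1) = m := by omega
  have e2 : m + 2 * (j + 1) - 2 * j = m + 2 := by omega
  have e3 : m + 2 * (j + 1) - 1 - (j + 1) = m + j := by omega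
  have e4 : m + 2 * (j + 1) - 1 - j = m + j + 1 := by omega
  have h1 : ((j + 1).factorial : ℝ) = (j + 1) * j.factorial := by
    rw [Nat.factorial_succ]; push_cast; ring
  have h2 : ((m + 2).factorial : ℝ) = (m + 2) * (m + 1) * m.factorial := by
    rw [Nat.factorial_succ, Nat.factorial_succ]; push_cast; ring
  have h3 : (j.factorial : ℝ) ≠ 0 := by positivity
  have h4 : (m.factorial : ℝ) ≠ 0 := by positivity
  have h5 : (j : ℝ) + 1 ≠ 0 := by positivity
  have h6 : (m : ℝ) + 1 ≠ 0 := by positivity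
  have h7 : (m : ℝ) + 2 ≠ 0 := by positivity
  simp only [QCoeff, e1, e2, e3, e4, h1, h2, ascPochhammer_succ_eval]
  push_cast
  field_simp
  ring

/-- With `λ = d/2`, the two Gegenbauer coefficients of `t ^ (k - 2j)` share the factor
`(λ)_(k-1-j)`; what remains is `(λ + k - 1 - j) + j = λ + k - 1`. For `k = 0` the closed form is not
the right one. -/
theorem eval_Q {k : ℕ} (hk : 1 ≤ k) (t : ℝ) :
    (Q d k).eval t = ∑ j ∈ Finset.range (k / 2 + 1), QCoeff d k j * t ^ (k - 2 * j) := by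
  rcases k with _ | _ | k
  · omega
  · simp [Q, gegenbauerC, QCoeff]
    ring
  · have hr : (k + 1 + 1) / 2 + 1 = (k / 2 + 1) + 1 := by omega
    simp only [Q, gegenbauerC, eval_sub, eval_finsetSum, eval_mul, eval_C, eval_pow, eval_X,
      eval_ofNat, hr]
    rw [Finset.sum_range_succ', Finset.sum_range_succ' (n := k / 2 + 1), add_sub_right_comm,
      ← Finset.sum_sub_distrib]
    congr 1
    · refine Finset.sum_congr rfl fun j hj => ?_
      have hj' : 2 * j ≤ k := by have := Finset.mem_range.1 hj; omega
      obtain ⟨m, rfl⟩ : ∃ m, k = m + 2 * j := ⟨k - 2 * j, by omega⟩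
      have e1 : m + 2 * j + 1 + 1 - 2 * (j + 1) = m := by omega
      have e2 : m + 2 * j - 2 * j = m := by omega
      have e3 : m + 2 * j + 1 + 1 - 1 - (j + 1) = m + j := by omega
      have e4 : m + 2 * j + 1 + 1 - (j + 1) = m + j + 1 := by omega
      have e5 : m + 2 * j - j = m + j := by omega
      have h1 : ((j + 1).factorial : ℝ) = (j + 1) * j.factorial := by
        rw [Nat.factorial_succ]; push_cast; ring
      have h3 : (j.factorial : ℝ) ≠ 0 := by positivity
      have h4 : (m.factorial : ℝ) ≠ 0 := by positivity
      have h5 : (j : ℝ) + 1 ≠ 0 := by positivity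
      simp only [QCoeff, e1, e2, e3, e4, e5, h1, ascPochhammer_succ_eval, mul_pow]
      push_cast
      field_simp
      ring
    · simp only [QCoeff, mul_zero, Nat.sub_zero, pow_zero, one_mul, Nat.factorial_zero,
        Nat.cast_one, mul_pow, ascPochhammer_succ_eval, Nat.add_sub_cancel]
      push_cast
      ring

/-- The zonal harmonic of degree `k ≥ 1` with pole `y`: the homogeneous polynomial which is
`Q d k ⟨y, ·⟩` on the sphere. -/
noncomputable def zonal (k : ℕ) (y : Fin d → ℝ) : MvPolynomial (Fin d) ℝ :=
  ∑ j ∈ Finset.range (k / 2 + 1),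
    MvPolynomial.C (QCoeff d k j) * (linForm y ^ (k - 2 * j) * normSqPoly d ^ j)

theorem eval_zonal {k : ℕ} (hk : 1 ≤ k) {x : Fin d → ℝ} (hx : ∑ i, x i ^ 2 = 1)
    (y : Fin d → ℝ) :
    MvPolynomial.eval x (zonal k y) = (Q d k).eval (∑ i, y i * x i) := by
  rw [eval_Q hk]
  simp [zonal, linForm, normSqPoly, hx]

theorem laplacian_zonal (k : ℕ) {y : Fin d → ℝ} (hy : ∑ i, y i ^ 2 = 1) :
    laplacian d (zonal k y) = 0 := by
  simp only [zonal, map_sum, ← MvPolynomial.smul_eq_C_mul, map_smul,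
    laplacian_linForm_pow_mul_normSqPoly_pow hy, smul_add, smul_smul, Finset.sum_add_distrib]
  -- The first family, at `j`, is to cancel the second, at `j + 1`. The two unmatched ends vanish:
  -- the last `j` leaves an exponent 0 or 1 of the linear form, and the term `j = 0` carries the
  -- factor `j`.
  rw [Finset.sum_range_succ, Finset.sum_range_succ' (n := k / 2)]
  have hlast : ((k - 2 * (k / 2) : ℕ) : ℝ) * ((k - 2 * (k / 2) : ℕ) - 1 : ℝ) = 0 := by
    rcases (by omega : k - 2 * (k / 2) = 0 ∨ k - 2 * (k / 2) = 1) with h | h <;> simp [h]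
  rw [hlast]
  simp only [Nat.cast_zero, mul_zero, zero_mul, zero_smul, add_zero]
  rw [← Finset.sum_add_distrib]
  refine Finset.sum_eq_zero fun j hj => ?_
  have hj' : 2 * (j + 1) ≤ k := by have := Finset.mem_range.1 hj; omega
  have e : k - 2 * j - 2 = k - 2 * (j + 1) := by omega
  have c1 : ((k - 2 * j : ℕ) : ℝ) = k - 2 * j := by
    rw [Nat.cast_sub (by omega)]; push_cast; ring
  have c2 : ((k - 2 * (j + 1) : ℕ) : ℝ) = k - 2 * (j + 1) := by
    rw [Nat.cast_sub (by omega)]; push_cast; ring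
  rw [e, Nat.add_sub_cancel, ← add_smul, c1, c2]
  have := QCoeff_succ (d := d) k j hj'
  push_cast
  rw [show (j : ℝ) + 1 - 1 = j by ring, this, add_neg_cancel, zero_smul]

theorem isHomogeneous_linForm (y : Fin d → ℝ) : (linForm y).IsHomogeneous 1 :=
  MvPolynomial.IsHomogeneous.sum _ _ _ fun i _ => MvPolynomial.isHomogeneous_C_mul_X _ i

theorem isHomogeneous_normSqPoly : (normSqPoly d).IsHomogeneous 2 :=
  MvPolynomial.IsHomogeneous.sum _ _ _ fun i _ => MvPolynomial.isHomogeneous_X_pow i 2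

theorem zonal_mem_harm (k : ℕ) {y : Fin d → ℝ} (hy : ∑ i, y i ^ 2 = 1) :
    zonal k y ∈ harm d k := by
  refine ⟨MvPolynomial.IsHomogeneous.sum _ _ _ fun j hj => ?_, laplacian_zonal k hy⟩
  have hj' := Finset.mem_range.1 hj
  have h := (((isHomogeneous_linForm y).pow (k - 2 * j)).mul
    (isHomogeneous_normSqPoly (d := d).pow j)).C_mul (QCoeff d k j)
  convert h using 1
  omega

/-- Up to the factor `k! QCoeff d k 0`, the zonal harmonics are the reproducing kernel of
`harm d k` for the Fischer inner product. -/
theorem fischer_zonal (k : ℕ) (y : Fin d → ℝ) {p : MvPolynomial (Fin d) ℝ} (hp : p ∈ harm d k) :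
    fischer d (zonal k y) p = QCoeff d k 0 * k.factorial * MvPolynomial.eval y p := by
  have hΔ : laplacian d p = 0 := hp.2
  -- Only `j = 0` survives: any other term has a factor `|x|²`, which moves across as the Laplacian
  -- of `p`.
  rw [zonal, map_sum, LinearMap.sum_apply, Finset.sum_range_succ', Finset.sum_eq_zero, zero_add]
  · rw [← MvPolynomial.smul_eq_C_mul, map_smul, LinearMap.smul_apply, mul_zero, Nat.sub_zero,
      pow_zero, mul_one, fischer_linForm_pow y k p hp.1, smul_eq_mul, mul_assoc]
  · intro j _
    rw [← MvPolynomial.smul_eq_C_mul, map_smul, LinearMap.smul_apply, pow_succ', mul_left_comm,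
      fischer_normSqPoly_mul, hΔ, map_zero, smul_zero]

/-! ### Sums of zonal harmonics over a point configuration -/

theorem sum_sq_coe_sphere (x : Sph d) : ∑ i, x.1 i ^ 2 = 1 := by
  have h := EuclideanSpace.real_norm_sq_eq x.1
  rw [norm_eq_of_mem_sphere x] at h
  linarith

theorem sum_mul_coe_sphere (x y : Sph d) :
    ∑ i, x.1 i * y.1 i = inner ℝ (x : EuclideanSpace ℝ (Fin d)) y := by
  rw [PiLp.inner_apply]
  exact Finset.sum_congr rfl fun i _ => by simp [mul_comm]

variable {n : ℕ}

/-- The sum of the zonal harmonics with poles `v 1, …, v n`. -/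
noncomputable def zonalSum (k : ℕ) (v : Fin n → Sph d) : MvPolynomial (Fin d) ℝ :=
  ∑ j, zonal k fun i => (v j).1 i

theorem zonalSum_mem_harm (k : ℕ) (v : Fin n → Sph d) : zonalSum k v ∈ harm d k :=
  Submodule.sum_mem _ fun j _ => zonal_mem_harm k (sum_sq_coe_sphere (v j))

theorem fischer_zonalSum (k : ℕ) (v : Fin n → Sph d) {p : MvPolynomial (Fin d) ℝ}
    (hp : p ∈ harm d k) :
    fischer d (zonalSum k v) p =
      QCoeff d k 0 * k.factorial * ∑ j, restrict d p (v j) := by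
  rw [zonalSum, map_sum, LinearMap.sum_apply, Finset.mul_sum]
  exact Finset.sum_congr rfl fun j _ => fischer_zonal k _ hp

theorem restrict_zonalSum {k : ℕ} (hk : 1 ≤ k) (v : Fin n → Sph d) (x : Sph d) :
    restrict d (zonalSum k v) x = ∑ j, (Q d k).eval (inner ℝ (v j).1 x.1) := by
  simp only [zonalSum, map_sum, Finset.sum_apply]
  refine Finset.sum_congr rfl fun j _ => ?_
  rw [← sum_mul_coe_sphere]
  exact eval_zonal hk (sum_sq_coe_sphere x) _

/-- The reproducing property applied to the kernel sum itself exhibits the double sum of `Q_k` as a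
multiple of a square. -/
theorem fischer_zonalSum_self {k : ℕ} (hk : 1 ≤ k) (v : Fin n → Sph d) :
    fischer d (zonalSum k v) (zonalSum k v) =
      QCoeff d k 0 * k.factorial * ∑ i, ∑ j, (Q d k).eval (inner ℝ (v j).1 (v i).1) := by
  rw [fischer_zonalSum k v (zonalSum_mem_harm k v)]
  simp only [restrict_zonalSum hk]

theorem sum_eval_Q_nonneg (hd : 1 ≤ d) {k : ℕ} (hk : 1 ≤ k) (v : Fin n → Sph d) :
    0 ≤ ∑ i, ∑ j, (Q d k).eval (inner ℝ (v j).1 (v i).1) := by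
  have h := fischer_self_nonneg (zonalSum k v)
  rw [fischer_zonalSum_self hk] at h
  have := QCoeff_zero_pos hd hk
  exact nonneg_of_mul_nonneg_right h (by positivity)

/-- By definiteness, a zero double sum forces `zonalSum k v = 0`, and pairing this with `p` gives
the point sum of `p`. Conversely, `zonalSum k v` is itself an admissible `p`. -/
theorem sum_eval_Q_eq_zero_iff (hd : 1 ≤ d) {k : ℕ} (hk : 1 ≤ k) (v : Fin n → Sph d) :
    ∑ i, ∑ j, (Q d k).eval (inner ℝ (v j).1 (v i).1) = 0 ↔
      ∀ p ∈ harm d k, ∑ j, restrict d p (v j) = 0 := by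
  constructor
  · intro h p hp
    have hT := fischer_zonalSum_self hk v
    rw [h, mul_zero] at hT
    have hp' := fischer_zonalSum k v hp
    rw [eq_zero_of_fischer_self_eq_zero hT, map_zero, LinearMap.zero_apply] at hp'
    have := QCoeff_zero_pos hd hk
    exact (mul_eq_zero.1 hp'.symm).resolve_left (by positivity)
  · intro h
    have := h _ (zonalSum_mem_harm k v)
    simpa only [restrict_zonalSum hk] using this

/-! ### Harmonic polynomials have mean zero on the sphere -/

/-- Polar coordinates for the product of a positively homogeneous function with a radial one. -/
theorem integral_mul_radial_eq (g : EuclideanSpace ℝ (Fin d) → ℝ) (h : ℝ → ℝ) (k : ℕ)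
    (hd : 1 ≤ d) (hg : ∀ (r : ℝ) x, 0 < r → g (r • x) = r ^ k * g x) :
    ∫ x, g x * h ‖x‖ = (∫ s : Sph d, g s ∂(volume : Measure (EuclideanSpace ℝ (Fin d))).toSphere) *
      ∫ r : Set.Ioi (0 : ℝ), r.1 ^ k * h r ∂(Measure.volumeIoiPow (d - 1)) := by
  have : Nonempty (Fin d) := ⟨⟨0, hd⟩⟩
  set μ : Measure (EuclideanSpace ℝ (Fin d)) := volume
  calc
    ∫ x, g x * h ‖x‖ = ∫ x : ({(0)}ᶜ : Set (EuclideanSpace ℝ (Fin d))),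
        g x.1 * h ‖x.1‖ ∂(μ.comap (↑)) := by
      rw [integral_subtype_comap (measurableSet_singleton _).compl fun x => g x * h ‖x‖,
        restrict_compl_singleton]
    _ = ∫ z : Sph d × Set.Ioi (0 : ℝ), g z.1 * (z.2.1 ^ k * h z.2)
        ∂μ.toSphere.prod (.volumeIoiPow (Module.finrank ℝ (EuclideanSpace ℝ (Fin d)) - 1)) := by
      rw [← μ.measurePreserving_homeomorphUnitSphereProd.integral_comp
        (Homeomorph.measurableEmbedding _)]
      refine integral_congr_ae (Filter.Eventually.of_forall fun x => ?_)
      have hx : 0 < ‖x.1‖ := norm_pos_iff.2 x.2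
      have h1 : g x.1 = ‖x.1‖ ^ k * g (‖x.1‖⁻¹ • x.1) := by
        rw [← hg _ _ hx, smul_inv_smul₀ hx.ne']
      simp only [homeomorphUnitSphereProd_apply_fst_coe, homeomorphUnitSphereProd_apply_snd_coe]
      rw [h1]
      ring
    _ = _ := by
      rw [integral_prod_mul (fun s : Sph d => g s) fun r : Set.Ioi (0 : ℝ) => r.1 ^ k * h r,
        finrank_euclideanSpace_fin]

/-- Squaring the positive part removes its corner at 0, so the cutoff below is differentiable
everywhere. -/
theorem hasDerivAt_max_zero_sq (s : ℝ) :
    HasDerivAt (fun s : ℝ => (max 0 s) ^ 2) (2 * max 0 s) s := by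
  rcases lt_trichotomy s 0 with hs | rfl | hs
  · rw [max_eq_left hs.le, mul_zero]
    refine (hasDerivAt_const s (0 : ℝ)).congr_of_eventuallyEq ?_
    filter_upwards [eventually_lt_nhds hs] with t ht
    simp [max_eq_left ht.le]
  · rw [hasDerivAt_iff_isLittleO_nhds_zero]
    simp only [max_self, zero_add, mul_zero, smul_zero, sub_zero, ne_eq, OfNat.ofNat_ne_zero,
      not_false_eq_true, zero_pow]
    refine Asymptotics.IsBigO.trans_isLittleO (g := fun t : ℝ => t ^ 2) ?_ ?_
    · refine Asymptotics.IsBigO.of_bound 1 (Filter.Eventually.of_forall fun t => ?_)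
      rw [one_mul, norm_pow, norm_pow]
      gcongr
      rw [Real.norm_eq_abs, Real.norm_eq_abs, abs_of_nonneg (le_max_left _ _)]
      exact max_le (abs_nonneg t) (le_abs_self t)
    · simpa using Asymptotics.isLittleO_pow_id (𝕜 := ℝ) one_lt_two
  · rw [max_eq_right hs.le]
    have := hasDerivAt_pow 2 s
    simp only [Nat.cast_ofNat, Nat.add_one_sub_one, pow_one] at this
    refine this.congr_of_eventuallyEq ?_
    filter_upwards [eventually_gt_nhds hs] with t ht
    simp [max_eq_right ht.le]

theorem hasLineDerivAt_eval (p : MvPolynomial (Fin d) ℝ) (i : Fin d)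
    (x : EuclideanSpace ℝ (Fin d)) :
    HasLineDerivAt ℝ (fun x : EuclideanSpace ℝ (Fin d) => MvPolynomial.eval (fun i => x i) p)
      (MvPolynomial.eval (fun i => x i) (MvPolynomial.pderiv i p)) x
      (EuclideanSpace.single i 1) := by
  classical
  unfold HasLineDerivAt
  induction p using MvPolynomial.induction_on with
  | C a => simpa using hasDerivAt_const (0 : ℝ) a
  | add p q hp hq => simpa using hp.fun_add hq
  | mul_X p j hp =>
    have hX : HasDerivAt (fun t : ℝ => (x + t • EuclideanSpace.single i (1 : ℝ)) j)
        (Pi.single (M := fun _ => ℝ) i 1 j) 0 := by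
      have := ((hasDerivAt_id (0 : ℝ)).mul_const
        (Pi.single (M := fun _ => ℝ) i 1 j)).const_add (x j)
      simpa [Pi.single_apply] using this
    simp only [map_mul, MvPolynomial.eval_X]
    refine (hp.fun_mul hX).congr_deriv ?_
    by_cases h : i = j
    · subst h; simp; ring
    · simp [Ne.symm h]; ring

theorem hasLineDerivAt_cutoff (i : Fin d) (x : EuclideanSpace ℝ (Fin d)) :
    HasLineDerivAt ℝ (fun x : EuclideanSpace ℝ (Fin d) => (max 0 (1 - ‖x‖ ^ 2)) ^ 2)
      (-4 * x i * max 0 (1 - ‖x‖ ^ 2)) x (EuclideanSpace.single i 1) := by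
  have h1 : HasDerivAt (fun t : ℝ => 1 - ‖x + t • EuclideanSpace.single i (1 : ℝ)‖ ^ 2)
      (-2 * x i) 0 := by
    have h : ∀ t : ℝ, 1 - ‖x + t • EuclideanSpace.single i (1 : ℝ)‖ ^ 2
        = (1 - ‖x‖ ^ 2) - (2 * x i) * t - t ^ 2 := by
      intro t
      rw [norm_add_sq_real, inner_smul_right, norm_smul, EuclideanSpace.inner_single_right]
      simp
      ring
    simp only [h]
    have := (((hasDerivAt_id (0 : ℝ)).const_mul (2 * x i)).const_sub (1 - ‖x‖ ^ 2)).fun_sub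
      (hasDerivAt_pow 2 (0 : ℝ))
    simpa using this
  have h2 := (hasDerivAt_max_zero_sq (1 - ‖x + (0 : ℝ) • EuclideanSpace.single i (1 : ℝ)‖ ^ 2)).comp
    (0 : ℝ) h1
  unfold HasLineDerivAt
  refine h2.congr_deriv ?_
  rw [zero_smul, add_zero]
  ring

theorem hasCompactSupport_cutoff (d : ℕ) :
    HasCompactSupport fun x : EuclideanSpace ℝ (Fin d) => max 0 (1 - ‖x‖ ^ 2) := by
  refine HasCompactSupport.intro (isCompact_closedBall 0 1) fun x hx => ?_
  have hx' : 1 < ‖x‖ := by simpa using hx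
  exact max_eq_left (by nlinarith)

theorem continuous_eval_euclidean (p : MvPolynomial (Fin d) ℝ) :
    Continuous fun x : EuclideanSpace ℝ (Fin d) => MvPolynomial.eval (fun i => x i) p :=
  p.continuous_eval.comp (by fun_prop)

theorem integrable_mul_cutoff {g : EuclideanSpace ℝ (Fin d) → ℝ} (hg : Continuous g) :
    Integrable fun x => g x * max 0 (1 - ‖x‖ ^ 2) :=
  (hg.mul (by fun_prop)).integrable_of_hasCompactSupport (hasCompactSupport_cutoff d).mul_left

/-- With `φ = (max 0 (1 - |x|²))²`, integration by parts gives `0 = ∫ Δp φ = -∫ ∇p · ∇φ`. Since `∇φ`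
is radial, Euler's identity makes the right side `4k ∫ p max 0 (1 - |x|²)`. -/
theorem integral_harm_mul_cutoff {k : ℕ} (hk : 1 ≤ k) {p : MvPolynomial (Fin d) ℝ}
    (hp : p ∈ harm d k) :
    ∫ x : EuclideanSpace ℝ (Fin d), MvPolynomial.eval (fun i => x i) p * max 0 (1 - ‖x‖ ^ 2) = 0 := by
  have hw : Continuous fun x : EuclideanSpace ℝ (Fin d) => max 0 (1 - ‖x‖ ^ 2) := by fun_prop
  have hsq : ∀ g : EuclideanSpace ℝ (Fin d) → ℝ, Continuous g →
      Integrable fun x => g x * (max 0 (1 - ‖x‖ ^ 2)) ^ 2 := by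
    intro g hg
    refine (integrable_mul_cutoff (hg.mul hw)).congr (Filter.Eventually.of_forall fun x => ?_)
    simp only [Pi.mul_apply]
    ring
  have hi : ∀ i : Fin d, Integrable fun x : EuclideanSpace ℝ (Fin d) =>
      MvPolynomial.eval (fun i => x i) (MvPolynomial.pderiv i p) *
        (-4 * x i * max 0 (1 - ‖x‖ ^ 2)) := by
    intro i
    refine (integrable_mul_cutoff ((continuous_eval_euclidean (MvPolynomial.pderiv i p)).mul
      (by fun_prop : Continuous fun x : EuclideanSpace ℝ (Fin d) => -4 * x i))).congr
      (Filter.Eventually.of_forall fun x => ?_)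
    simp only [Pi.mul_apply]
    ring
  have hparts : ∀ i : Fin d,
      ∫ x : EuclideanSpace ℝ (Fin d), MvPolynomial.eval (fun i => x i) (MvPolynomial.pderiv i p) *
        (-4 * x i * max 0 (1 - ‖x‖ ^ 2)) =
      -∫ x : EuclideanSpace ℝ (Fin d), MvPolynomial.eval (fun i => x i)
        (MvPolynomial.pderiv i (MvPolynomial.pderiv i p)) * (max 0 (1 - ‖x‖ ^ 2)) ^ 2 := fun i =>
    integral_bilinear_hasLineDerivAt_right_eq_neg_left_of_integrable
      (B := ContinuousLinearMap.mul ℝ ℝ)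
      (hsq _ (continuous_eval_euclidean _)) (hi i) (hsq _ (continuous_eval_euclidean _))
      (fun x _ => hasLineDerivAt_eval _ i x) (fun x _ => hasLineDerivAt_cutoff i x)
  have hsum := Finset.sum_congr rfl fun i (_ : i ∈ Finset.univ) => hparts i
  rw [Finset.sum_neg_distrib, ← integral_finsetSum _ fun i _ => hi i,
    ← integral_finsetSum _ fun i _ => hsq _ (continuous_eval_euclidean _)] at hsum
  have hΔ : laplacian d p = 0 := hp.2
  have h0 : ∀ x : EuclideanSpace ℝ (Fin d), ∑ i, MvPolynomial.eval (fun i => x i)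
        (MvPolynomial.pderiv i (MvPolynomial.pderiv i p)) * (max 0 (1 - ‖x‖ ^ 2)) ^ 2 = 0 := by
    intro x
    rw [← Finset.sum_mul, ← map_sum, ← laplacian_apply, hΔ, map_zero, zero_mul]
  have hE : ∀ x : EuclideanSpace ℝ (Fin d),
      ∑ i, MvPolynomial.eval (fun i => x i) (MvPolynomial.pderiv i p) *
        (-4 * x i * max 0 (1 - ‖x‖ ^ 2)) =
      (-4 * k) * (MvPolynomial.eval (fun i => x i) p * max 0 (1 - ‖x‖ ^ 2)) := by
    intro x
    have he := congrArg (MvPolynomial.eval fun i => x i)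
      (MvPolynomial.IsHomogeneous.sum_X_mul_pderiv hp.1)
    simp only [map_sum, map_mul, MvPolynomial.eval_X, nsmul_eq_mul, map_natCast] at he
    rw [mul_assoc, ← mul_assoc (k : ℝ), ← he, Finset.sum_mul, Finset.mul_sum]
    exact Finset.sum_congr rfl fun i _ => by ring
  simp only [h0, hE, integral_zero, neg_zero] at hsum
  rw [integral_const_mul] at hsum
  have : (k : ℝ) ≠ 0 := by positivity
  exact (mul_eq_zero.1 hsum).resolve_left (by simpa using this)

theorem eval_smul_of_isHomogeneous {k : ℕ} {p : MvPolynomial (Fin d) ℝ} (hp : p.IsHomogeneous k)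
    (r : ℝ) (x : Fin d → ℝ) :
    MvPolynomial.eval (fun i => r * x i) p = r ^ k * MvPolynomial.eval x p := by
  rw [MvPolynomial.eval_eq, MvPolynomial.eval_eq, Finset.mul_sum]
  refine Finset.sum_congr rfl fun m hm => ?_
  have hk : ∑ i ∈ m.support, m i = k := by
    have := hp (MvPolynomial.mem_support_iff.1 hm)
    simpa [Finsupp.weight_apply, Finsupp.sum] using this
  rw [← hk, Finset.prod_congr rfl fun i _ => mul_pow r (x i) (m i), Finset.prod_mul_distrib,
    Finset.prod_pow_eq_pow_sum]
  ring

theorem integral_pow_mul_cutoff_ne_zero (hd : 1 ≤ d) (k : ℕ) :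
    ∫ r : Set.Ioi (0 : ℝ), r.1 ^ k * max 0 (1 - r.1 ^ 2) ∂(Measure.volumeIoiPow (d - 1)) ≠ 0 := by
  intro h
  have hpolar := integral_mul_radial_eq (fun x : EuclideanSpace ℝ (Fin d) => ‖x‖ ^ k)
    (fun r => max 0 (1 - r ^ 2)) k hd fun r x hr => by
      rw [norm_smul, mul_pow, Real.norm_of_nonneg hr.le]
  rw [h, mul_zero] at hpolar
  refine ne_of_gt ?_ hpolar
  have : Nonempty (Fin d) := ⟨⟨0, hd⟩⟩
  -- Undoing polar coordinates for `‖x‖ ^ k` gives a continuous nonnegative integrand, nonzero at a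
  -- point of norm `1 / 2`.
  refine Continuous.integral_pos_of_hasCompactSupport_nonneg_nonzero
    (x := EuclideanSpace.single ⟨0, hd⟩ (1 / 2 : ℝ)) (by fun_prop)
    (hasCompactSupport_cutoff d).mul_left (fun x => by positivity) ?_
  simp only [PiLp.norm_single, ne_eq]
  norm_num

/-- In polar coordinates the vanishing integral over space is the sphere integral times a nonzero
radial integral. -/
theorem integral_restrict_harm (hd : 1 ≤ d) {k : ℕ} (hk : 1 ≤ k) {p : MvPolynomial (Fin d) ℝ}
    (hp : p ∈ harm d k) : ∫ x, restrict d p x ∂(surfaceMeasure d) = 0 := by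
  have h := integral_harm_mul_cutoff hk hp
  rw [integral_mul_radial_eq (fun x : EuclideanSpace ℝ (Fin d) =>
    MvPolynomial.eval (fun i => x i) p) (fun r => max 0 (1 - r ^ 2)) k hd
    fun r x _ => eval_smul_of_isHomogeneous hp.1 r x] at h
  rw [surfaceMeasure, integral_smul_measure]
  refine smul_eq_zero_of_right _ ?_
  exact (mul_eq_zero.1 h).resolve_right (integral_pow_mul_cutoff_ne_zero hd k)

instance (d : ℕ) : IsFiniteMeasureOnCompacts (surfaceMeasure d) := by
  -- If the total mass is zero, the normalising factor is `∞`, but the measure being scaled is then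
  -- zero.
  by_cases h : (volume : Measure (EuclideanSpace ℝ (Fin d))).toSphere Set.univ = 0
  · have : (volume : Measure (EuclideanSpace ℝ (Fin d))).toSphere = 0 :=
      Measure.measure_univ_eq_zero.1 h
    rw [surfaceMeasure, this, smul_zero]
    infer_instance
  · exact IsFiniteMeasureOnCompacts.smul _ (ENNReal.inv_ne_top.2 h)

theorem continuous_restrict (p : MvPolynomial (Fin d) ℝ) : Continuous (restrict d p) :=
  (continuous_eval_euclidean p).comp continuous_subtype_val

/-! ### Designs for harmonic spaces -/

theorem sum_restrict_eq_zero_of_isDesign (hd : 1 ≤ d) {k : ℕ} (hk : 1 ≤ k)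
    {U : Submodule ℝ (Sph d → ℝ)} {v : Fin n → Sph d} (hv : IsDesign U v) (hn : n ≠ 0)
    (hU : (harm d k).map (restrict d) ≤ U) {p : MvPolynomial (Fin d) ℝ} (hp : p ∈ harm d k) :
    ∑ j, restrict d p (v j) = 0 := by
  have h := hv.integral_eq _ (hU (Submodule.mem_map_of_mem hp))
  rw [integral_restrict_harm hd hk hp, ← Finset.mul_sum] at h
  exact (mul_eq_zero.1 h.symm).resolve_left (by positivity)

theorem map_harm_le_harmSpace {k : ℕ} {K : Set ℕ} (hk : k ∈ K) :
    (harm d k).map (restrict d) ≤ harmSpace d K :=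
  le_iSup₂_of_le k hk le_rfl

theorem isDesign_harmSpace_iff (hd : 1 ≤ d) {K : Set ℕ} (hK : 0 ∉ K) (hn : n ≠ 0)
    (v : Fin n → Sph d) :
    IsDesign (harmSpace d K) v ↔
      ∀ k ∈ K, ∀ p ∈ harm d k, ∑ j, restrict d p (v j) = 0 := by
  have hpos : ∀ k ∈ K, 1 ≤ k := fun k hk =>
    Nat.one_le_iff_ne_zero.2 fun h => hK (h ▸ hk)
  constructor
  · intro hv k hk p hp
    exact sum_restrict_eq_zero_of_isDesign hd (hpos k hk) hv hn (map_harm_le_harmSpace hk) hp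
  · intro h
    have hn' : (n : ℝ) ≠ 0 := by exact_mod_cast hn
    refine ⟨fun _ => by positivity, by simp [hn'], fun p hp => ?_⟩
    -- Continuity is carried through the induction to provide the integrability behind additivity of
    -- the integral.
    suffices Continuous p ∧ ∫ x, p x ∂(surfaceMeasure d) = 0 ∧ ∑ j, p (v j) = 0 by
      rw [this.2.1, ← Finset.mul_sum, this.2.2, mul_zero]
    rw [harmSpace, iSup_subtype'] at hp
    induction hp using Submodule.iSup_induction' with
    | mem k q hq =>
      obtain ⟨p, hp, rfl⟩ := hq
      exact ⟨continuous_restrict p, integral_restrict_harm hd (hpos k k.2) hp, h k k.2 p hp⟩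
    | zero => exact ⟨continuous_const, by simp, by simp⟩
    | add p q _ _ hp hq =>
      refine ⟨hp.1.add hq.1, ?_, ?_⟩
      · simp only [Pi.add_apply]
        rw [integral_add (hp.1.integrable_of_hasCompactSupport (HasCompactSupport.of_compactSpace _))
          (hq.1.integrable_of_hasCompactSupport (HasCompactSupport.of_compactSpace _)),
          hp.2.1, hq.2.1, add_zero]
      · simp only [Pi.add_apply, Finset.sum_add_distrib, hp.2.2, hq.2.2, add_zero]

theorem Q_zero (d : ℕ) : Q d 0 = 1 := by
  simp [Q, gegenbauerC]

theorem inner_self_sphere (x : Sph d) :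
    inner ℝ (x : EuclideanSpace ℝ (Fin d)) (x : EuclideanSpace ℝ (Fin d)) = 1 := by
  rw [real_inner_self_eq_norm_sq, norm_eq_of_mem_sphere x, one_pow]

theorem inner_mem_Icc (x y : Sph d) :
    inner ℝ (x : EuclideanSpace ℝ (Fin d)) (y : EuclideanSpace ℝ (Fin d)) ∈
      Set.Icc (-1 : ℝ) 1 := by
  have h := abs_real_inner_le_norm (x : EuclideanSpace ℝ (Fin d)) (y : EuclideanSpace ℝ (Fin d))
  rw [norm_eq_of_mem_sphere x, norm_eq_of_mem_sphere y, one_mul] at h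
  exact abs_le.1 h

end SphericalDesign

/-! ### The double count and the equality case -/

open SphericalDesign in
theorem mainTheorem10 (d : ℕ) (hd : 1 ≤ d) (L : Set ℕ)
    (P : Submodule ℝ (MvPolynomial (Fin d) ℝ))
    (hP : P.map (SphericalDesign.restrict d) = SphericalDesign.harmSpace d L)
    (f : ℕ →₀ ℝ) (F : Polynomial ℝ)
    (hF : F = f.sum (fun k a => a • SphericalDesign.Q d k))
    (hL : {k | 0 < f k} = L ∪ {0})
    (hpos : ∀ α ∈ Set.Icc (-1 : ℝ) 1, 0 ≤ F.eval α)
    (n : ℕ) (v : Fin n → SphericalDesign.Sph d)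
    (hv : SphericalDesign.IsDesign (P.map (SphericalDesign.restrict d)) v) :
    F.eval 1 / f 0 ≤ (n : ℝ) ∧
      ((n : ℝ) = F.eval 1 / f 0 ↔
        Function.Injective v ∧
          (∀ α ∈ SphericalDesign.angles v, F.IsRoot α) ∧
          SphericalDesign.IsDesign (SphericalDesign.harmSpace d {k | f k < 0}) v) := by
  have hn : n ≠ 0 := by
    rintro rfl
    simpa using hv.sum_eq_one
  have hn' : (0 : ℝ) < n := by positivity
  have hf0 : 0 < f 0 := by
    have : 0 ∈ {k | 0 < f k} := hL ▸ Or.inr rfl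
    exact this
  rw [hP] at hv
  set S : ℕ → ℝ := fun k => ∑ i, ∑ j, (Q d k).eval (inner ℝ (v j).1 (v i).1) with hS
  set R : ℝ := ∑ k ∈ f.support.erase 0, f k * S k with hR
  -- `O` runs over distinct indices, not distinct points, so a repeated point contributes `F(1)`.
  set O : ℝ := ∑ i, ∑ j, if i = j then 0 else F.eval (inner ℝ (v j).1 (v i).1) with hO
  have hpos' : ∀ k ∈ f.support.erase 0, 1 ≤ k := fun k hk =>
    Nat.one_le_iff_ne_zero.2 (Finset.ne_of_mem_erase hk)
  have hterm : ∀ k ∈ f.support.erase 0, f k * S k ≤ 0 := by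
    intro k hk
    have hk1 := hpos' k hk
    rcases lt_or_ge 0 (f k) with hfk | hfk
    · have hkL : k ∈ L := by
        have : k ∈ L ∪ {0} := hL ▸ hfk
        exact this.resolve_right (Finset.ne_of_mem_erase hk)
      have : S k = 0 := (sum_eval_Q_eq_zero_iff hd hk1 v).2 fun p hp =>
        sum_restrict_eq_zero_of_isDesign hd hk1 hv hn (map_harm_le_harmSpace hkL) hp
      rw [this, mul_zero]
    · exact mul_nonpos_of_nonpos_of_nonneg hfk (sum_eval_Q_nonneg hd hk1 v)
  have hR0 : R ≤ 0 := Finset.sum_nonpos hterm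
  have hRiff : R = 0 ↔ IsDesign (harmSpace d {k | f k < 0}) v := by
    rw [isDesign_harmSpace_iff hd (by simpa using hf0.le) hn, hR,
      Finset.sum_eq_zero_iff_of_nonpos hterm]
    constructor
    · intro h k (hk : f k < 0)
      have hk' : k ∈ f.support.erase 0 := by
        refine Finset.mem_erase.2 ⟨?_, Finsupp.mem_support_iff.2 hk.ne⟩
        rintro rfl
        exact hk.not_gt hf0
      exact (sum_eval_Q_eq_zero_iff hd (hpos' k hk') v).1
        ((mul_eq_zero.1 (h k hk')).resolve_left hk.ne)
    · intro h k hk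
      refine (hterm k hk).antisymm ?_
      rcases lt_or_ge (f k) 0 with hfk | hfk
      · have : S k = 0 := (sum_eval_Q_eq_zero_iff hd (hpos' k hk) v).2 (h k hfk)
        rw [this, mul_zero]
      · exact mul_nonneg hfk (sum_eval_Q_nonneg hd (hpos' k hk) v)
  have hOterm : ∀ i j, 0 ≤ if i = j then 0 else F.eval (inner ℝ (v j).1 (v i).1) := by
    intro i j
    split_ifs
    exacts [le_rfl, hpos _ (inner_mem_Icc _ _)]
  have hO0 : 0 ≤ O := Finset.sum_nonneg fun i _ => Finset.sum_nonneg fun j _ => hOterm i j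
  have hOiff : O = 0 ↔ ∀ i j, i ≠ j → F.eval (inner ℝ (v j).1 (v i).1) = 0 := by
    rw [hO, Finset.sum_eq_zero_iff_of_nonneg fun i _ => Finset.sum_nonneg fun j _ => hOterm i j]
    simp only [Finset.mem_univ, true_implies]
    refine forall_congr' fun i => ?_
    rw [Finset.sum_eq_zero_iff_of_nonneg fun j _ => hOterm i j]
    simp
  have hdiag : ∑ i, ∑ j, F.eval (inner ℝ (v j).1 (v i).1) = n * F.eval 1 + O := by
    have : ∀ i j, F.eval (inner ℝ (v j).1 (v i).1) = (if i = j then F.eval 1 else 0) +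
        if i = j then 0 else F.eval (inner ℝ (v j).1 (v i).1) := by
      intro i j
      by_cases h : i = j
      · subst h; simp only [inner_self_sphere, if_true, add_zero]
      · simp [h]
    rw [Finset.sum_congr rfl fun i _ => Finset.sum_congr rfl fun j _ => this i j]
    simp [Finset.sum_add_distrib, hO]
  have hexp : ∑ i, ∑ j, F.eval (inner ℝ (v j).1 (v i).1) = f 0 * n ^ 2 + R := by
    have h0 : S 0 = n ^ 2 := by simp [hS, Q_zero, pow_two]
    have h0mem : 0 ∈ f.support := Finsupp.mem_support_iff.2 hf0.ne'
    rw [hR, ← h0, Finset.add_sum_erase _ (fun k => f k * S k) h0mem]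
    simp only [hF, Finsupp.sum, eval_finsetSum, eval_smul, smul_eq_mul, hS, Finset.mul_sum]
    rw [Finset.sum_comm (s := f.support)]
    exact Finset.sum_congr rfl fun i _ => Finset.sum_comm
  have hkey : n * (n * f 0 - F.eval 1) = O - R := by linarith
  have heq : (n : ℝ) = F.eval 1 / f 0 ↔ O = 0 ∧ R = 0 := by
    rw [eq_div_iff hf0.ne']
    constructor
    · intro h
      rw [h, sub_self, mul_zero] at hkey
      constructor <;> linarith
    · rintro ⟨h1, h2⟩
      rw [h1, h2, sub_zero] at hkey
      linarith [(mul_eq_zero.1 hkey).resolve_left hn'.ne']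
  refine ⟨?_, ?_⟩
  · rw [div_le_iff₀ hf0]
    have : 0 ≤ n * (n * f 0 - F.eval 1) := by rw [hkey]; linarith
    linarith [nonneg_of_mul_nonneg_right this hn']
  constructor
  · intro h
    obtain ⟨h1, h2⟩ := heq.1 h
    -- In the equality case `F(1) = n f_0 > 0`, so a repeated point would contradict the vanishing
    -- of the off-diagonal terms.
    have hF1 : F.eval 1 ≠ 0 := by
      rw [eq_div_iff hf0.ne'] at h
      rw [← h]
      positivity
    rw [hOiff] at h1
    refine ⟨fun i j hij => ?_, ?_, hRiff.1 h2⟩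
    · by_contra hne
      have := h1 i j hne
      rw [hij, inner_self_sphere] at this
      exact hF1 this
    · rintro α ⟨i, j, hij, rfl⟩
      exact h1 j i fun h => hij (h ▸ rfl)
  · rintro ⟨hinj, hang, hdes⟩
    refine heq.2 ⟨hOiff.2 fun i j hij => ?_, hRiff.2 hdes⟩
    -- Angles only involve distinct points; injectivity is what makes every off-diagonal pair
    -- contribute an angle.
    exact hang _ ⟨j, i, fun h => hij (hinj h).symm, rfl⟩
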